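/- Let $L$, $S$, $S'$ be finite-dimensional quantum systems with $L\neq 0$. Let $\mathcal N_S(\cdot)=\sum_i K_i(\cdot)K_i^\dagger$ be a noise channel from $S$ to $S'$ (for instance $S'=S$) with finitely many Kraus operators, $\sum_i K_i^\dagger K_i=\mathbb 1$. Let $H_L$, $H_S$ be arbitrary Hermitian operators on $L$, $S$, let $U_{L,\theta}=e^{-iH_L\theta}$, $U_{S,\theta}=e^{-iH_S\theta}$, $\mathcal U_{X,\theta}(\cdot)=U_{X,\theta}(\cdot)U_{X,\theta}^\dagger$, and assume the Hamiltonian-in-Kraus-span condition $H_S\in\mathrm{span}_{\mathbb C}\{K_i^\dagger K_j\}_{i,j}$. Let $\mathcal E$ be an encoding channel from $L$ to $S$ with dual map $\mathcal E^\dagger$ (so $\mathrm{Tr}(\mathcal E^\dagger(H)X)=\mathrm{Tr}(H\mathcal E(X))$). For Hermitian $A$ let $\Delta A$ be the largest minus the smallest eigenvalue. For states put $f(\rho,\sigma)=\mathrm{Tr}\sqrt{\rho^{1/2}\sigma\rho^{1/2}}$ and $P(\rho,\sigma)=\sqrt{1-f(\rho,\sigma)^2}$; for channels put $P(\Phi_1,\Phi_2)=\sup_\rho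 P((\Phi_1\otimes\mathbb 1)(\rho),(\Phi_2\otimes\mathbb 1)(\rho))$, over all states $\rho$ of the input together with a finite-dimensional reference system. Define - the QEC inaccuracy $\epsilon=\inf_{\mathcal R}P(\mathcal R\circ\mathcal N_S\circ\mathcal E,\mathbb 1_L)$, over all channels $\mathcal R$ from $S'$ to $L$; - $\mathfrak J=\inf\{\Delta h: h \text{ Hermitian},\ H_S=\sum_{ij}h_{ij}K_i^\dagger K_j\}$; - the local covariance violation $\delta_{\mathrm P}=\sqrt{F(\mathcal U_{S,\theta}\circ\mathcal E\circ\mathcal U_{L,\theta}^\dagger)|_{\theta=0}}$, where $F(\Phi_\theta)=\sup_\rho F((\Phi_\theta\otimes\mathbb 1)(\rho))$ is the channel quantum Fisher information (QFI), the supremum being over states with a finite-dimensional reference as above, and $F(\rho_\theta)=2\,\partial^2_{\theta'}P(\rho_\theta,\rho_{\theta'})^2|_{\theta'=\theta}$ is the QFI of a family of states; - the charge conservation violation $\delta_{\mathrm C}=\Delta(H_L-\mathcal E^\dagger(H_S))$. Then 1. if $\mathcal E$ is isometric, i.e. $\mathcal E(\cdot)=V(\cdot)V^\dagger$ with $V^\dagger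 V=\mathbb 1_L$, then $\delta_{\mathrm P}+2\epsilon\mathfrak J\ge\Delta H_L$; 2. for every encoding channel $\mathcal E$, $\delta_{\mathrm C}+2\epsilon\mathfrak J\ge\Delta H_L$. -/

import Mathlib

open scoped Matrix MatrixOrder ComplexOrder

noncomputable section

namespace CovariantCodes

variable {A B : Type*} [Fintype A] [DecidableEq A] [Fintype B] [DecidableEq B]

/-- Linear maps from operators on the finite-dimensional system `A` (with orthonormal basis
indexed by `A`) to operators on the system `B`. -/
abbrev SuperOp (A B : Type*) := Matrix A A ℂ →ₗ[ℂ] Matrix B B ℂ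

/-- Density operators. -/
def IsState (ρ : Matrix A A ℂ) : Prop := ρ.PosSemidef ∧ ρ.trace = 1

/-- The map `X ↦ K X Kᴴ`. -/
def conjMap (K : Matrix B A ℂ) : SuperOp A B where
  toFun X := K * X * Kᴴ
  map_add' X Y := by simp [Matrix.mul_add, Matrix.add_mul]
  map_smul' c X := by simp

/-- The map `X ↦ ∑ i, K i X (K i)ᴴ`. -/
def krausMap {κ : Type*} [Fintype κ] (K : κ → Matrix B A ℂ) : SuperOp A B :=
  ∑ i, conjMap (K i)

/-- The Kraus operators `K i` satisfy the trace-preservation condition. -/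
def IsKrausFamily {κ : Type*} [Fintype κ] (K : κ → Matrix B A ℂ) : Prop :=
  ∑ i, (K i)ᴴ * K i = 1

/-- Quantum channels, in operator-sum form. -/
def IsChannel (Φ : SuperOp A B) : Prop :=
  ∃ (r : ℕ) (K : Fin r → Matrix B A ℂ), IsKrausFamily K ∧ Φ = krausMap K

/-- Isometric channels `X ↦ V X Vᴴ` with `Vᴴ V = 1`. -/
def IsIsometric (Φ : SuperOp A B) : Prop :=
  ∃ V : Matrix B A ℂ, Vᴴ * V = 1 ∧ Φ = conjMap V

/-- `(Φ ⊗ 1_R)(ρ)`: the map `Φ` acts on each `R`-block of `ρ`. -/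
def extend (R : Type*) (Φ : SuperOp A B) (ρ : Matrix (A × R) (A × R) ℂ) :
    Matrix (B × R) (B × R) ℂ :=
  Matrix.of fun x y => Φ (Matrix.of fun a a' => ρ (a, x.2) (a', y.2)) x.1 y.1

/-- The dual map `Φ†` (Heisenberg picture), see `trace_dualMap_mul`. -/
def dualMap (Φ : SuperOp A B) (H : Matrix B B ℂ) : Matrix A A ℂ :=
  Matrix.of fun a a' => (H * Φ (Matrix.single a' a 1)).trace

set_option linter.unusedSectionVars false in
/-- The defining property of the dual map: `Tr(Φ†(H) X) = Tr(H Φ(X))`. -/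
theorem trace_dualMap_mul (Φ : SuperOp A B) (H : Matrix B B ℂ) (X : Matrix A A ℂ) :
    (dualMap Φ H * X).trace = (H * Φ X).trace := by
  have h1 : ∀ (a a' : A), Matrix.single a a' (X a a') = X a a' • Matrix.single a a' (1 : ℂ) := by
    intro a a'; simp
  conv_rhs => rw [Matrix.matrix_eq_sum_single X]
  simp only [h1, map_sum, map_smul, Matrix.mul_sum, Matrix.trace_sum, Matrix.mul_smul,
    Matrix.trace_smul, smul_eq_mul]
  rw [Finset.sum_comm]
  simp only [Matrix.trace, Matrix.diag, Matrix.mul_apply, dualMap, Matrix.of_apply]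
  exact Finset.sum_congr rfl fun a _ => Finset.sum_congr rfl fun a' _ => mul_comm _ _

/-- The fidelity `Tr √(ρ^{1/2} σ ρ^{1/2})`. -/
def fidelity (ρ σ : Matrix A A ℂ) : ℝ :=
  (CFC.sqrt (CFC.sqrt ρ * σ * CFC.sqrt ρ)).trace.re

/-- The purified distance between states. -/
def purifiedDist (ρ σ : Matrix A A ℂ) : ℝ := √(1 - fidelity ρ σ ^ 2)

/-- The channel purified distance: the supremum over all input states on the input system
together with a reference system of arbitrary finite dimension `n`. -/
def channelPurifiedDist (Φ Ψ : SuperOp A B) : ℝ :=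
  sSup {p | ∃ (n : ℕ) (ρ : Matrix (A × Fin n) (A × Fin n) ℂ), IsState ρ ∧
    p = purifiedDist (extend (Fin n) Φ ρ) (extend (Fin n) Ψ ρ)}

/-- The QEC inaccuracy of the noisy encoding `M` (noise after encoding): the infimum over recovery
channels of the channel purified distance between the recovered map and the identity. -/
def qecInaccuracy (M : SuperOp A B) : ℝ :=
  sInf {e | ∃ Rec : SuperOp B A, IsChannel Rec ∧
    e = channelPurifiedDist (Rec ∘ₗ M) LinearMap.id}

/-- The quantum Fisher information at `θ` of a one-parameter family of states. -/
def stateQFI (ρ : ℝ → Matrix A A ℂ) (θ : ℝ) : ℝ :=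
  2 * iteratedDeriv 2 (fun θ' => purifiedDist (ρ θ) (ρ θ') ^ 2) θ

/-- The channel quantum Fisher information at `θ` of a one-parameter family of channels, a supremum
in `[0, ∞]` over all input states with a reference system of arbitrary finite dimension. -/
def channelQFI (Φ : ℝ → SuperOp A B) (θ : ℝ) : ENNReal :=
  ⨆ (n : ℕ) (ρ : Matrix (A × Fin n) (A × Fin n) ℂ) (_ : IsState ρ),
    ENNReal.ofReal (stateQFI (fun t => extend (Fin n) (Φ t) ρ) θ)

/-- The unitary `exp(-i θ H)`. -/
def evol (H : Matrix A A ℂ) (θ : ℝ) : Matrix A A ℂ :=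
  NormedSpace.exp ((-Complex.I * (θ : ℂ)) • H)

/-- The local covariance violation `δ_P`: the square root of the channel QFI at `θ = 0` of
`𝒰_{S,θ} ∘ E ∘ 𝒰_{L,θ}†`. -/
def localViolation (HA : Matrix A A ℂ) (HB : Matrix B B ℂ) (E : SuperOp A B) : ENNReal :=
  channelQFI (fun θ => conjMap (evol HB θ) ∘ₗ E ∘ₗ conjMap (evol HA θ)ᴴ) 0 ^ (1 / 2 : ℝ)

/-- `Δ H`: largest minus smallest eigenvalue of a Hermitian matrix. -/
def spread (H : Matrix A A ℂ) : ℝ := sSup (spectrum ℝ H) - sInf (spectrum ℝ H)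

/-- The charge conservation violation `δ_C = Δ(H_L - E†(H_S))`. -/
def chargeViolation (HA : Matrix A A ℂ) (HB : Matrix B B ℂ) (E : SuperOp A B) : ℝ :=
  spread (HA - dualMap E HB)

/-- The Hamiltonian-in-Kraus-span condition. -/
def HKS {κ : Type*} (H : Matrix A A ℂ) (K : κ → Matrix B A ℂ) : Prop :=
  H ∈ Submodule.span ℂ {M | ∃ i j, M = (K i)ᴴ * K j}

/-- The quantity `𝔍`: the infimum of `Δ h` over the Hermitian `h` with
`H = ∑ i j, h i j • (K i)ᴴ K j`. -/
def frakJ {κ : Type*} [Fintype κ] [DecidableEq κ]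
    (H : Matrix A A ℂ) (K : κ → Matrix B A ℂ) : ℝ :=
  sInf {d | ∃ h : Matrix κ κ ℂ, h.IsHermitian ∧
    H = ∑ i, ∑ j, h i j • ((K i)ᴴ * K j) ∧ d = spread h}

end CovariantCodes

end

/-!
The quantity that connects charge and error correction is the *charge fluctuation*
`χ = ⟨x₀|E†(HS)|x₀⟩ - ⟨x₁|E†(HS)|x₁⟩`, where `x₀`, `x₁` are unit eigenvectors of `HL` for its largest
and smallest eigenvalue.

**Error correction makes `χ` small.** If `HS = ∑ h i j • (K i)ᴴ K j`, then the physical charge is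
the expectation of `h` on the environment of the noise, and `χ` compares the environments of the two
encoded states. Let `R` be a recovery channel and let `ε` be the distance of the recovered channel
from the identity. Applied to the test state `(x₀ ⊗ e₀ + x₁ ⊗ e₁)/√2`, with orthonormal reference
vectors `e₀`, `e₁`, closeness to the identity says that the Stinespring vectors `T x₀`, `T x₁` of the
recovered channel are close to `x₀ ⊗ w`, `x₁ ⊗ w` for one common environment vector `w`
(`one_sub_sum_normSq_le`). Since `h` has the same expectation in the latter two vectors, and since
expectations in two pure states differ by at most `Δh` times their purified distance
(`expectation_sub_le`), it follows that `χ ≤ 2 ε Δh` (`environment_expectation_sub_le`,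
`logical_charge_sub_le`). Taking infima over `R` and `h` gives `χ ≤ 2 ε 𝔍`.

**A small `χ` forces a violation of covariance.** The difference `ΔHL - χ` compares the expectations
of `HL - E†(HS)` in `x₀` and `x₁`, so it is at most `δ_C`
(`spread_le_chargeViolation_add`). For an isometric encoding `E(X) = V X Vᴴ` one moreover has
`δ_C ≤ δ_P` (`chargeViolation_le_localViolation`): put `D = HL - Vᴴ HS V` and let `ψ` be the balanced
superposition of extremal eigenvectors of `D`. With the generator `G = HS V - V HL`, the QFI in the
input state `ψ` is `4 (‖G ψ‖² - ⟨D⟩²)`, which is at least four times the variance `(ΔD)² / 4` of `D`,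
because `Vᴴ G = -D` and `Vᴴ` is a contraction (`four_mul_variance_le_stateQFI`).
-/

noncomputable section

set_option linter.unusedSectionVars false

namespace CovariantCodes

open Matrix
open scoped Kronecker

/-! ### Quadratic forms of Hermitian matrices -/

section QuadraticForms

variable {n : Type*} [Fintype n]

theorem star_dotProduct_comm_of_isHermitian {H : Matrix n n ℂ} (hH : H.IsHermitian) (x y : n → ℂ) :
    star y ⬝ᵥ H *ᵥ x = star (star x ⬝ᵥ H *ᵥ y) := by
  rw [star_dotProduct, star_mulVec, hH.eq, dotProduct_mulVec]

theorem star_dotProduct_self_re_eq (x : n → ℂ) : (star x ⬝ᵥ x).re = ∑ i, Complex.normSq (x i) := by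
  simp [dotProduct, Complex.re_sum, Complex.normSq_apply]

theorem star_dotProduct_self_eq_ofReal (x : n → ℂ) :
    star x ⬝ᵥ x = ((∑ i, Complex.normSq (x i) : ℝ) : ℂ) := by
  push_cast
  simp [dotProduct, Complex.normSq_eq_conj_mul_self]

theorem normSq_dotProduct_le (x y : n → ℂ) :
    Complex.normSq (star x ⬝ᵥ y) ≤ (star x ⬝ᵥ x).re * (star y ⬝ᵥ y).re := by
  have h := norm_inner_le_norm (𝕜 := ℂ) (WithLp.toLp 2 x) (WithLp.toLp 2 y)
  rw [EuclideanSpace.inner_eq_star_dotProduct] at h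
  have h2 := mul_self_le_mul_self (norm_nonneg _) h
  rw [dotProduct_comm, Complex.norm_mul_self_eq_normSq] at h2
  refine h2.trans (le_of_eq ?_)
  rw [mul_mul_mul_comm, ← sq, ← sq, EuclideanSpace.norm_sq_eq, EuclideanSpace.norm_sq_eq,
    star_dotProduct_self_re_eq, star_dotProduct_self_re_eq]
  simp [Complex.normSq_eq_norm_sq]

/-- If the quadratic form of a Hermitian matrix `H` takes values in `[lo, hi]` on unit vectors,
then its expectations in two pure states differ by at most `hi - lo` times the purified distance of
the states.  After multiplying `b` by a phase that makes `⟨a, b⟩` real, the difference is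
`Re ⟨a - b, H (a + b)⟩`, and `‖a - b‖² ‖a + b‖² = 4 (1 - ⟨a, b⟩²)`. -/
theorem expectation_sub_le {H : Matrix n n ℂ} (hH : H.IsHermitian) {lo hi : ℝ}
    (hlo : ∀ x : n → ℂ, lo * (star x ⬝ᵥ x).re ≤ (star x ⬝ᵥ H *ᵥ x).re)
    (hhi : ∀ x : n → ℂ, (star x ⬝ᵥ H *ᵥ x).re ≤ hi * (star x ⬝ᵥ x).re)
    {a b : n → ℂ} (ha : star a ⬝ᵥ a = 1) (hb : star b ⬝ᵥ b = 1) :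
    (star a ⬝ᵥ H *ᵥ a).re - (star b ⬝ᵥ H *ᵥ b).re ≤
      (hi - lo) * √(1 - Complex.normSq (star a ⬝ᵥ b)) := by
  obtain ⟨c, hc1, hc⟩ := RCLike.exists_norm_eq_mul_self (K := ℂ) (star a ⬝ᵥ b)
  have hcc : star c * c = 1 := by
    have := Complex.normSq_eq_conj_mul_self (z := c)
    rw [Complex.normSq_eq_norm_sq, hc1] at this
    simpa using this.symm
  set k : ℝ := ‖star a ⬝ᵥ b‖ with hk
  rw [Complex.normSq_eq_norm_sq, ← hk]
  -- `d` is `b` up to a phase, with `⟨a, d⟩` real.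
  obtain ⟨d, hd⟩ : ∃ d : n → ℂ, d = c • b := ⟨_, rfl⟩
  have had : star a ⬝ᵥ d = k := by rw [hd, dotProduct_smul, smul_eq_mul, ← hc]; rfl
  have hda : star d ⬝ᵥ a = k := by
    rw [star_dotProduct, had]
    simp
  have hdd : star d ⬝ᵥ d = 1 := by
    rw [hd, star_smul, smul_dotProduct, dotProduct_smul, hb, smul_eq_mul, smul_eq_mul, mul_one, hcc]
  have hHd : star d ⬝ᵥ H *ᵥ d = star b ⬝ᵥ H *ᵥ b := by
    rw [hd, star_smul, smul_dotProduct, mulVec_smul, dotProduct_smul, smul_smul, hcc, one_smul]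
  rw [← hHd]
  set p := (star a ⬝ᵥ H *ᵥ a).re
  set q := (star d ⬝ᵥ H *ᵥ d).re
  set m := (star a ⬝ᵥ H *ᵥ d).re with hm
  have hm' : (star d ⬝ᵥ H *ᵥ a).re = m := by
    rw [star_dotProduct_comm_of_isHermitian hH]; simp [hm]
  have key : ∀ s t : ℝ, (star ((s : ℂ) • a + (t : ℂ) • d) ⬝ᵥ ((s : ℂ) • a + (t : ℂ) • d)).re
        = s ^ 2 + 2 * s * t * k + t ^ 2 ∧
      (star ((s : ℂ) • a + (t : ℂ) • d) ⬝ᵥ H *ᵥ ((s : ℂ) • a + (t : ℂ) • d)).re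
        = s ^ 2 * p + 2 * s * t * m + t ^ 2 * q := by
    intro s t
    constructor
    · simp [star_add, star_smul, add_dotProduct, dotProduct_add, smul_dotProduct,
        dotProduct_smul, ha, had, hda, hdd]
      ring
    · simp [star_add, star_smul, add_dotProduct, dotProduct_add, smul_dotProduct,
        dotProduct_smul, mulVec_add, mulVec_smul, hm', p, q, ← hm]
      ring
  -- Add the upper bound at `t (a - d) + (a + d)` to the lower bound at `t (a - d) - (a + d)`.
  have hquad : ∀ t : ℝ, 0 ≤ (hi - lo) * (1 - k) * (t * t) + (-(2 * (p - q))) * t +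
      (hi - lo) * (1 + k) := by
    intro t
    have h1 := hhi (((t + 1 : ℝ) : ℂ) • a + ((1 - t : ℝ) : ℂ) • d)
    have h2 := hlo (((t - 1 : ℝ) : ℂ) • a + ((-t - 1 : ℝ) : ℂ) • d)
    rw [(key _ _).1, (key _ _).2] at h1 h2
    nlinarith
  have hdisc := discrim_le_zero hquad
  rw [discrim] at hdisc
  have hM : 0 ≤ hi - lo := by
    have h1 := hlo a
    have h2 := hhi a
    rw [ha] at h1 h2
    simp at h1 h2
    linarith
  rw [← Real.sqrt_sq hM, ← Real.sqrt_mul (sq_nonneg _)]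
  refine Real.le_sqrt_of_sq_le ?_
  nlinarith

theorem dotProduct_one_kronecker_mulVec {m : Type*} [Fintype m] [DecidableEq m] (h : Matrix n n ℂ)
    (x y : m × n → ℂ) :
    star x ⬝ᵥ ((1 : Matrix m m ℂ) ⊗ₖ h) *ᵥ y =
      ∑ a, star (fun i => x (a, i)) ⬝ᵥ h *ᵥ (fun i => y (a, i)) := by
  simp [dotProduct, mulVec, Fintype.sum_prod_type, Matrix.one_apply, Finset.sum_ite_eq]

variable [DecidableEq n]

theorem isHermitian_form_bounds {H : Matrix n n ℂ} (hH : H.IsHermitian) (x : n → ℂ) :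
    sInf (spectrum ℝ H) * (star x ⬝ᵥ x).re ≤ (star x ⬝ᵥ H *ᵥ x).re ∧
      (star x ⬝ᵥ H *ᵥ x).re ≤ sSup (spectrum ℝ H) * (star x ⬝ᵥ x).re := by
  have hfin : (spectrum ℝ H).Finite := Matrix.finite_real_spectrum
  have h1 : algebraMap ℝ _ (sInf (spectrum ℝ H)) ≤ H :=
    algebraMap_le_of_le_spectrum (fun r hr => csInf_le hfin.bddBelow hr) hH
  have h2 : H ≤ algebraMap ℝ _ (sSup (spectrum ℝ H)) :=
    le_algebraMap_of_spectrum_le (fun r hr => le_csSup hfin.bddAbove hr) hH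
  have e : ∀ r : ℝ, (star x ⬝ᵥ (algebraMap ℝ (Matrix n n ℂ) r) *ᵥ x).re =
      r * (star x ⬝ᵥ x).re := by
    intro r
    rw [Algebra.algebraMap_eq_smul_one, smul_mulVec, one_mulVec, dotProduct_smul]
    simp
  constructor
  · have := (Complex.le_def.1 ((Matrix.le_iff.1 h1).dotProduct_mulVec_nonneg x)).1
    rw [sub_mulVec, dotProduct_sub, Complex.sub_re, e] at this
    simpa using this
  · have := (Complex.le_def.1 ((Matrix.le_iff.1 h2).dotProduct_mulVec_nonneg x)).1
    rw [sub_mulVec, dotProduct_sub, Complex.sub_re, e] at this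
    simpa using this

theorem spread_nonneg (H : Matrix n n ℂ) : 0 ≤ spread H := by
  have hfin : (spectrum ℝ H).Finite := Matrix.finite_real_spectrum
  rw [spread, sub_nonneg]
  exact Real.sInf_le_sSup _ hfin.bddBelow hfin.bddAbove

/-- Unit eigenvectors for the largest and the smallest eigenvalue; they are orthogonal unless the
two eigenvalues agree. -/
theorem exists_extremal_eigenvectors [Nonempty n] {H : Matrix n n ℂ} (hH : H.IsHermitian) :
    ∃ (x y : n → ℂ) (μ ν : ℝ), star x ⬝ᵥ x = 1 ∧ star y ⬝ᵥ y = 1 ∧ H *ᵥ x = (μ : ℂ) • x ∧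
      H *ᵥ y = (ν : ℂ) • y ∧ spread H = μ - ν ∧ (μ ≠ ν → star x ⬝ᵥ y = 0) := by
  have hfin : (spectrum ℝ H).Finite := Matrix.finite_real_spectrum
  have hr := hH.spectrum_real_eq_range_eigenvalues
  have hne : (spectrum ℝ H).Nonempty := hr ▸ Set.range_nonempty _
  have h1 := hne.csSup_mem hfin
  have h2 := hne.csInf_mem hfin
  rw [hr] at h1 h2
  obtain ⟨i, hi⟩ := h1
  obtain ⟨j, hj⟩ := h2
  have ho : ∀ i j, star (hH.eigenvectorBasis i : n → ℂ) ⬝ᵥ (hH.eigenvectorBasis j : n → ℂ) =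
      if i = j then 1 else 0 := by
    intro i j
    have := orthonormal_iff_ite.1 hH.eigenvectorBasis.orthonormal i j
    rwa [EuclideanSpace.inner_eq_star_dotProduct, dotProduct_comm] at this
  refine ⟨hH.eigenvectorBasis i, hH.eigenvectorBasis j, hH.eigenvalues i, hH.eigenvalues j,
    by simp [ho], by simp [ho], hH.mulVec_eigenvectorBasis i, hH.mulVec_eigenvectorBasis j, ?_, ?_⟩
  · rw [spread, hr, hi, hj]
  · intro h
    rw [ho, if_neg]
    rintro rfl
    exact h rfl

end QuadraticForms

/-! ### Fidelity with pure states -/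

section Fidelity

variable {n : Type*} [Fintype n] [DecidableEq n]

theorem sqrt_vecMulVec_star (φ : n → ℂ) :
    CFC.sqrt (vecMulVec φ (star φ)) =
      (((√(star φ ⬝ᵥ φ).re)⁻¹ : ℝ) : ℂ) • vecMulVec φ (star φ) := by
  obtain ⟨r, hr⟩ : ∃ r, r = (star φ ⬝ᵥ φ).re := ⟨_, rfl⟩
  have hφ : star φ ⬝ᵥ φ = (r : ℂ) := by
    rw [hr, star_dotProduct_self_eq_ofReal]; simp
  have hr0 : 0 ≤ r := by
    rw [hr, star_dotProduct_self_re_eq]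
    exact Finset.sum_nonneg fun _ _ => Complex.normSq_nonneg _
  rw [← hr]
  refine CFC.sqrt_unique ?_ ?_
  · rw [smul_mul_smul_comm, vecMulVec_mul_vecMulVec, hφ]
    rcases hr0.eq_or_lt with h | h
    · have : φ = 0 := by
        have h' : star φ ⬝ᵥ φ = 0 := by rw [hφ, ← h]; simp
        exact dotProduct_star_self_eq_zero.1 h'
      simp [this]
    · have : ((√r)⁻¹ : ℝ) * (√r)⁻¹ * r = 1 := by
        have := Real.mul_self_sqrt hr0
        have h3 := (Real.sqrt_pos.2 h).ne'
        field_simp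
        rw [sq, this]
      rw [vecMulVec_smul, smul_smul, ← Complex.ofReal_mul, ← Complex.ofReal_mul, this]
      simp
  · rw [nonneg_iff_posSemidef]
    exact (posSemidef_vecMulVec_self_star φ).smul (Complex.zero_le_real.2 (by positivity))

/-- The fidelity with a pure state is the square root of an overlap. -/
theorem fidelity_vecMulVec {σ : Matrix n n ℂ} (hσ : σ.PosSemidef) (ψ : n → ℂ) :
    fidelity σ (vecMulVec ψ (star ψ)) = √(star ψ ⬝ᵥ σ *ᵥ ψ).re := by
  have hs : (CFC.sqrt σ).IsHermitian := (nonneg_iff_posSemidef.1 (CFC.sqrt_nonneg σ)).isHermitian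
  have h1 : CFC.sqrt σ * vecMulVec ψ (star ψ) * CFC.sqrt σ =
      vecMulVec (CFC.sqrt σ *ᵥ ψ) (star (CFC.sqrt σ *ᵥ ψ)) := by
    rw [mul_vecMulVec, vecMulVec_mul, star_mulVec, hs.eq]
  have h2 : star (CFC.sqrt σ *ᵥ ψ) ⬝ᵥ (CFC.sqrt σ *ᵥ ψ) = star ψ ⬝ᵥ σ *ᵥ ψ := by
    rw [star_mulVec, hs.eq, ← dotProduct_mulVec, mulVec_mulVec,
      CFC.sqrt_mul_sqrt_self σ (nonneg_iff_posSemidef.2 hσ)]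
  have h0 : 0 ≤ (star ψ ⬝ᵥ σ *ᵥ ψ).re := (Complex.le_def.1 (hσ.dotProduct_mulVec_nonneg ψ)).1
  rw [fidelity, h1, sqrt_vecMulVec_star, trace_smul, trace_vecMulVec, dotProduct_comm _ (star _), h2]
  simp only [smul_eq_mul, Complex.re_ofReal_mul]
  rcases h0.eq_or_lt with h | h
  · rw [← h]; simp
  · rw [inv_mul_eq_div, Real.div_sqrt]

/-- Only an inequality, because `purifiedDist` is `0` when the overlap exceeds `1`; equality would
need `σ` and `ψ` to be normalised. -/
theorem le_purifiedDist_sq_vecMulVec {σ : Matrix n n ℂ} (hσ : σ.PosSemidef) (ψ : n → ℂ) :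
    1 - (star ψ ⬝ᵥ σ *ᵥ ψ).re ≤ purifiedDist σ (vecMulVec ψ (star ψ)) ^ 2 := by
  have h0 : 0 ≤ (star ψ ⬝ᵥ σ *ᵥ ψ).re := (Complex.le_def.1 (hσ.dotProduct_mulVec_nonneg ψ)).1
  rw [purifiedDist, fidelity_vecMulVec hσ, Real.sq_sqrt h0]
  rcases le_total 0 (1 - (star ψ ⬝ᵥ σ *ᵥ ψ).re) with h | h
  · rw [Real.sq_sqrt h]
  · exact h.trans (sq_nonneg _)

theorem purifiedDist_sq_vecMulVec_vecMulVec {φ ψ : n → ℂ} (hφ : star φ ⬝ᵥ φ = 1)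
    (hψ : star ψ ⬝ᵥ ψ = 1) :
    purifiedDist (vecMulVec φ (star φ)) (vecMulVec ψ (star ψ)) ^ 2 =
      1 - Complex.normSq (star φ ⬝ᵥ ψ) := by
  have h : (star ψ ⬝ᵥ vecMulVec φ (star φ) *ᵥ ψ).re = Complex.normSq (star φ ⬝ᵥ ψ) := by
    rw [vecMulVec_mulVec, dotProduct_smul, star_dotProduct ψ φ]
    simp [Complex.normSq_apply]
  have hle := normSq_dotProduct_le φ ψ
  rw [hφ, hψ] at hle
  rw [purifiedDist, fidelity_vecMulVec (posSemidef_vecMulVec_self_star φ), h,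
    Real.sq_sqrt (Complex.normSq_nonneg _), Real.sq_sqrt]
  simpa using hle

theorem isState_vecMulVec {ψ : n → ℂ} (hψ : star ψ ⬝ᵥ ψ = 1) : IsState (vecMulVec ψ (star ψ)) :=
  ⟨posSemidef_vecMulVec_self_star ψ, by rw [trace_vecMulVec, dotProduct_comm, hψ]⟩

end Fidelity

/-! ### Kraus families and the channel distance -/

section Kraus

variable {A B C κ ι : Type*} [Fintype A] [DecidableEq A] [Fintype B] [DecidableEq B]
  [Fintype C] [DecidableEq C] [Fintype κ] [Fintype ι]

theorem krausMap_apply (K : κ → Matrix B A ℂ) (X : Matrix A A ℂ) :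
    krausMap K X = ∑ i, K i * X * (K i)ᴴ := by
  simp [krausMap, LinearMap.sum_apply, conjMap]

theorem krausMap_comp (K : κ → Matrix C B ℂ) (M : ι → Matrix B A ℂ) :
    krausMap K ∘ₗ krausMap M = krausMap fun p : κ × ι => K p.1 * M p.2 := by
  ext1 X
  rw [LinearMap.comp_apply]
  simp [krausMap_apply, Fintype.sum_prod_type, Matrix.mul_assoc]
  exact Finset.sum_comm

theorem isKrausFamily_comp {K : κ → Matrix C B ℂ} {M : ι → Matrix B A ℂ} (hK : IsKrausFamily K)
    (hM : IsKrausFamily M) : IsKrausFamily fun p : κ × ι => K p.1 * M p.2 := by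
  rw [IsKrausFamily, Fintype.sum_prod_type_right, ← hM]
  refine Finset.sum_congr rfl fun j _ => ?_
  have : ∀ i, (K i * M j)ᴴ * (K i * M j) = (M j)ᴴ * ((K i)ᴴ * K i) * M j := by
    intro i; simp [Matrix.mul_assoc]
  simp only [this]
  rw [← Matrix.sum_mul, ← Matrix.mul_sum, hK, Matrix.mul_one]

theorem dualMap_krausMap (K : κ → Matrix B A ℂ) (H : Matrix B B ℂ) :
    dualMap (krausMap K) H = ∑ i, (K i)ᴴ * H * K i := by
  refine Matrix.ext_iff_trace_mul_right.2 fun X => ?_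
  rw [trace_dualMap_mul, krausMap_apply, Matrix.mul_sum, Matrix.sum_mul, trace_sum, trace_sum]
  refine Finset.sum_congr rfl fun i _ => ?_
  rw [← Matrix.mul_assoc, Matrix.trace_mul_comm]
  simp only [Matrix.mul_assoc]

theorem extend_krausMap_vecMulVec {R : Type*} (K : κ → Matrix B A ℂ) (ψ : A × R → ℂ) :
    extend R (krausMap K) (vecMulVec ψ (star ψ)) =
      ∑ i, vecMulVec (fun x : B × R => (K i *ᵥ fun a => ψ (a, x.2)) x.1)
        (star fun x : B × R => (K i *ᵥ fun a => ψ (a, x.2)) x.1) := by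
  ext x y
  simp only [extend, of_apply, krausMap_apply, Matrix.sum_apply]
  refine Finset.sum_congr rfl fun i _ => ?_
  have : (of fun a a' => vecMulVec ψ (star ψ) (a, x.2) (a', y.2)) =
      vecMulVec (fun a => ψ (a, x.2)) (star fun a => ψ (a, y.2)) := by
    ext; simp [vecMulVec_apply]
  rw [this, mul_vecMulVec, vecMulVec_mul, ← star_mulVec]
  simp [vecMulVec_apply]

theorem extend_id {R : Type*} (ρ : Matrix (A × R) (A × R) ℂ) :
    extend R (LinearMap.id : SuperOp A A) ρ = ρ := by
  ext x y; simp [extend]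

theorem purifiedDist_le_one (ρ σ : Matrix A A ℂ) : purifiedDist ρ σ ≤ 1 := by
  rw [purifiedDist, Real.sqrt_le_one]
  nlinarith [sq_nonneg (fidelity ρ σ)]

theorem le_channelPurifiedDist (Φ Ψ : SuperOp A B) {r : ℕ} {ρ : Matrix (A × Fin r) (A × Fin r) ℂ}
    (hρ : IsState ρ) : purifiedDist (extend (Fin r) Φ ρ) (extend (Fin r) Ψ ρ) ≤
      channelPurifiedDist Φ Ψ := by
  refine le_csSup ⟨1, ?_⟩ ⟨r, ρ, hρ, rfl⟩
  rintro _ ⟨n, ρ, -, rfl⟩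
  exact purifiedDist_le_one _ _

theorem channelPurifiedDist_nonneg (Φ Ψ : SuperOp A B) : 0 ≤ channelPurifiedDist Φ Ψ := by
  refine Real.sSup_nonneg ?_
  rintro _ ⟨n, ρ, -, rfl⟩
  exact Real.sqrt_nonneg _

/-- The normalised sum of two unit vectors tagged by orthogonal reference states is a test state for the
distance of `krausMap T` from the identity: its overlap with the output is the squared length of
the vector of averaged diagonal amplitudes. -/
theorem one_sub_sum_normSq_le (T : κ → Matrix A A ℂ) {x : Fin 2 → A → ℂ}
    (hx : ∀ r, star (x r) ⬝ᵥ x r = 1) :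
    1 - ∑ k, Complex.normSq ((∑ r, star (x r) ⬝ᵥ T k *ᵥ x r) / 2) ≤
      channelPurifiedDist (krausMap T) LinearMap.id ^ 2 := by
  have hs : ((√2 : ℝ) : ℂ)⁻¹ * ((√2 : ℝ) : ℂ)⁻¹ = 1 / 2 := by
    rw [← mul_inv, ← Complex.ofReal_mul, Real.mul_self_sqrt (by norm_num)]; simp
  let ψ : A × Fin 2 → ℂ := fun p => ((√2 : ℝ) : ℂ)⁻¹ * x p.2 p.1
  have hψ : star ψ ⬝ᵥ ψ = 1 := by
    have : star ψ ⬝ᵥ ψ = ∑ r, (1 / 2) * (star (x r) ⬝ᵥ x r) := by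
      simp only [dotProduct, Fintype.sum_prod_type_right, Finset.mul_sum]
      refine Finset.sum_congr rfl fun r _ => Finset.sum_congr rfl fun a _ => ?_
      rw [← hs]; simp [ψ]; ring
    rw [this]; simp [hx]
  have hσ := extend_krausMap_vecMulVec T ψ
  have h1 : (extend (Fin 2) (krausMap T) (vecMulVec ψ (star ψ))).PosSemidef := by
    rw [hσ]
    exact posSemidef_sum _ fun i _ => posSemidef_vecMulVec_self_star _
  have h2 := le_purifiedDist_sq_vecMulVec h1 ψ
  have h3 := le_channelPurifiedDist (krausMap T) LinearMap.id (isState_vecMulVec hψ)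
  rw [extend_id] at h3
  refine le_trans ?_ (h2.trans (pow_le_pow_left₀ (Real.sqrt_nonneg _) h3 2))
  rw [hσ, sum_mulVec, dotProduct_sum, Complex.re_sum]
  refine sub_le_sub_left (Finset.sum_le_sum fun k _ => le_of_eq ?_) _
  have h4 : star ψ ⬝ᵥ (fun y : A × Fin 2 => (T k *ᵥ fun a => ψ (a, y.2)) y.1) =
      (∑ r, star (x r) ⬝ᵥ T k *ᵥ x r) / 2 := by
    rw [Finset.sum_div]
    simp only [dotProduct, Fintype.sum_prod_type_right, Finset.sum_div]
    refine Finset.sum_congr rfl fun r _ => Finset.sum_congr rfl fun a _ => ?_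
    have : (fun a => ψ (a, r)) = ((√2 : ℝ) : ℂ)⁻¹ • x r := by ext; simp [ψ]
    rw [this, mulVec_smul, div_eq_mul_one_div, ← hs]
    simp [ψ]; ring
  rw [vecMulVec_mulVec, dotProduct_smul, h4, star_dotProduct _ ψ, h4]
  simp [Complex.normSq_apply]
  ring

end Kraus

/-! ### Decoupling of the environment -/

section Decoupling

variable {A B C κ β : Type*} [Fintype A] [DecidableEq A] [Fintype B] [DecidableEq B]
  [Fintype C] [DecidableEq C] [Fintype κ] [DecidableEq κ] [Fintype β] [DecidableEq β]

/-- The Stinespring matrix of a Kraus family, with the environment split into an inaccessible part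
`β` and the part `κ` on which an observable is going to be measured. -/
def stinespring (T : β × κ → Matrix B A ℂ) : Matrix ((B × β) × κ) A ℂ :=
  Matrix.of fun p a => T (p.1.2, p.2) p.1.1 a

theorem stinespring_conj (T : β × κ → Matrix B A ℂ) (h : Matrix κ κ ℂ) :
    (stinespring T)ᴴ * ((1 : Matrix (B × β) (B × β) ℂ) ⊗ₖ h) * stinespring T =
      ∑ b, ∑ i, ∑ j, h i j • ((T (b, i))ᴴ * T (b, j)) := by
  ext x y
  have hxy : ((stinespring T)ᴴ * ((1 : Matrix (B × β) (B × β) ℂ) ⊗ₖ h) * stinespring T) x y =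
      star (fun p => stinespring T p x) ⬝ᵥ
        ((1 : Matrix (B × β) (B × β) ℂ) ⊗ₖ h) *ᵥ fun p => stinespring T p y := by
    rw [Matrix.mul_assoc]; rfl
  rw [hxy, dotProduct_one_kronecker_mulVec, Fintype.sum_prod_type_right]
  simp only [Matrix.sum_apply, Matrix.smul_apply, Matrix.mul_apply, conjTranspose_apply,
    stinespring, of_apply, smul_eq_mul, dotProduct, mulVec, Pi.star_apply]
  refine Finset.sum_congr rfl fun b _ => ?_
  rw [Finset.sum_comm]
  refine Finset.sum_congr rfl fun i _ => ?_
  simp only [Finset.mul_sum]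
  rw [Finset.sum_comm]
  refine Finset.sum_congr rfl fun j _ => Finset.sum_congr rfl fun a _ => ?_
  ring

theorem stinespring_conjTranspose_mul_self {T : β × κ → Matrix B A ℂ} (hT : IsKrausFamily T) :
    (stinespring T)ᴴ * stinespring T = 1 := by
  rw [← hT]
  ext x y
  simp only [Matrix.mul_apply, Matrix.sum_apply, conjTranspose_apply, stinespring, of_apply]
  simp only [Fintype.sum_prod_type]
  rw [Finset.sum_comm]
  refine Finset.sum_congr rfl fun b _ => ?_
  rw [Finset.sum_comm]

theorem exists_unit_star_dotProduct_eq (v : κ → ℂ) (hv : v ≠ 0) :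
    ∃ w : κ → ℂ, star w ⬝ᵥ w = 1 ∧ star w ⬝ᵥ v = (√(∑ k, Complex.normSq (v k)) : ℝ) := by
  have h1 : 0 < ∑ k, Complex.normSq (v k) := by
    obtain ⟨k, hk⟩ := Function.ne_iff.1 hv
    exact Finset.sum_pos' (fun _ _ => Complex.normSq_nonneg _)
      ⟨k, Finset.mem_univ _, Complex.normSq_pos.2 hk⟩
  have h2 := Real.mul_self_sqrt h1.le
  have h3 := (Real.sqrt_pos.2 h1).ne'
  have h4 : star (((√(∑ k, Complex.normSq (v k)))⁻¹ : ℝ) : ℂ) =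
      (((√(∑ k, Complex.normSq (v k)))⁻¹ : ℝ) : ℂ) := Complex.conj_ofReal _
  refine ⟨(((√(∑ k, Complex.normSq (v k)))⁻¹ : ℝ) : ℂ) • v, ?_, ?_⟩
  · rw [star_smul, smul_dotProduct, dotProduct_smul, star_dotProduct_self_eq_ofReal, h4,
      smul_eq_mul, smul_eq_mul, ← Complex.ofReal_mul, ← Complex.ofReal_mul,
      ← Complex.ofReal_one]
    congr 1
    nth_rewrite 3 [← h2]
    field_simp
  · rw [star_smul, smul_dotProduct, star_dotProduct_self_eq_ofReal, h4, smul_eq_mul,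
      ← Complex.ofReal_mul]
    congr 1
    nth_rewrite 2 [← h2]
    field_simp

/-- If a channel on `A` is close to the identity, its environment learns little about the input:
expectations of an environment observable `h` in two input states differ by at most `2 ε Δh`.
The Stinespring vectors `T x₀`, `T x₁` have, on average, overlap at least `√(1 - ε²)` with
`x₀ ⊗ w`, `x₁ ⊗ w` for a common environment vector `w`, and `h` has the same expectation in
these two. -/
theorem environment_expectation_sub_le {T : β × κ → Matrix A A ℂ} (hT : IsKrausFamily T)
    {h : Matrix κ κ ℂ} (hh : h.IsHermitian) {x : Fin 2 → A → ℂ}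
    (hx : ∀ r, star (x r) ⬝ᵥ x r = 1) :
    (star (x 0) ⬝ᵥ (∑ b, ∑ i, ∑ j, h i j • ((T (b, i))ᴴ * T (b, j))) *ᵥ x 0).re -
      (star (x 1) ⬝ᵥ (∑ b, ∑ i, ∑ j, h i j • ((T (b, i))ᴴ * T (b, j))) *ᵥ x 1).re ≤
      2 * channelPurifiedDist (krausMap T) LinearMap.id * spread h := by
  set H := (1 : Matrix (A × β) (A × β) ℂ) ⊗ₖ h with hHdef
  have hH : H.IsHermitian := by
    rw [IsHermitian, hHdef, conjTranspose_kronecker, hh.eq, conjTranspose_one]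
  have hsplit : ∀ y : (A × β) × κ → ℂ, star y ⬝ᵥ y =
      ∑ p, star (fun i => y (p, i)) ⬝ᵥ (fun i => y (p, i)) := by
    intro y; simp only [dotProduct, Fintype.sum_prod_type]; rfl
  have hlo : ∀ y : (A × β) × κ → ℂ,
      sInf (spectrum ℝ h) * (star y ⬝ᵥ y).re ≤ (star y ⬝ᵥ H *ᵥ y).re := by
    intro y
    rw [hHdef, dotProduct_one_kronecker_mulVec, hsplit, Complex.re_sum, Complex.re_sum,
      Finset.mul_sum]
    exact Finset.sum_le_sum fun p _ => (isHermitian_form_bounds hh _).1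
  have hhi : ∀ y : (A × β) × κ → ℂ,
      (star y ⬝ᵥ H *ᵥ y).re ≤ sSup (spectrum ℝ h) * (star y ⬝ᵥ y).re := by
    intro y
    rw [hHdef, dotProduct_one_kronecker_mulVec, hsplit, Complex.re_sum, Complex.re_sum,
      Finset.mul_sum]
    exact Finset.sum_le_sum fun p _ => (isHermitian_form_bounds hh _).2
  obtain ⟨a, ha⟩ : ∃ a : Fin 2 → (A × β) × κ → ℂ, ∀ r, a r = stinespring T *ᵥ x r :=
    ⟨_, fun _ => rfl⟩
  have haa : ∀ r, star (a r) ⬝ᵥ a r = 1 := by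
    intro r
    rw [ha, star_mulVec, ← dotProduct_mulVec, mulVec_mulVec,
      stinespring_conjTranspose_mul_self hT, one_mulVec, hx]
  have haH : ∀ r, star (x r) ⬝ᵥ (∑ b, ∑ i, ∑ j, h i j • ((T (b, i))ᴴ * T (b, j))) *ᵥ x r =
      star (a r) ⬝ᵥ H *ᵥ a r := by
    intro r
    rw [← stinespring_conj, ha, star_mulVec, ← dotProduct_mulVec, mulVec_mulVec, mulVec_mulVec,
      Matrix.mul_assoc]
  rw [haH, haH]
  obtain ⟨v, hv⟩ : ∃ v : β × κ → ℂ, ∀ k, v k = (∑ r, star (x r) ⬝ᵥ T k *ᵥ x r) / 2 :=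
    ⟨_, fun _ => rfl⟩
  have hdist := one_sub_sum_normSq_le T hx
  simp only [← hv] at hdist
  set ε := channelPurifiedDist (krausMap T) LinearMap.id
  have hε : 0 ≤ ε := channelPurifiedDist_nonneg _ _
  have hsp : sSup (spectrum ℝ h) - sInf (spectrum ℝ h) = spread h := rfl
  have hsp0 := spread_nonneg h
  by_cases hv0 : v = 0
  · -- Without overlap `ε ≥ 1`, and both expectations lie in the spectral range of `h`.
    have h1 : 1 ≤ ε := by
      rw [hv0] at hdist
      simp only [Pi.zero_apply, map_zero, Finset.sum_const_zero, sub_zero] at hdist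
      exact (one_le_sq_iff₀ hε).1 hdist
    have h2 := hhi (a 0)
    have h3 := hlo (a 1)
    rw [haa] at h2 h3
    simp only [Complex.one_re, mul_one] at h2 h3
    nlinarith
  · obtain ⟨w, hw, hwv⟩ := exists_unit_star_dotProduct_eq v hv0
    set N := ∑ k, Complex.normSq (v k)
    obtain ⟨b, hb⟩ : ∃ b : Fin 2 → (A × β) × κ → ℂ,
      ∀ r p, b r p = x r p.1.1 * w (p.1.2, p.2) := ⟨fun r p => _, fun _ _ => rfl⟩
    have hbb : ∀ r, star (b r) ⬝ᵥ b r = 1 := by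
      intro r
      have : star (b r) ⬝ᵥ b r = (star (x r) ⬝ᵥ x r) * (star w ⬝ᵥ w) := by
        simp only [dotProduct, Fintype.sum_prod_type, Finset.sum_mul, Finset.mul_sum]
        rw [← Finset.sum_comm_cycle]
        refine Finset.sum_congr rfl fun c _ => Finset.sum_congr rfl fun k _ =>
          Finset.sum_congr rfl fun i _ => ?_
        simp [hb, mul_mul_mul_comm]
      rw [this, hx, hw, one_mul]
    have hbH : ∀ r, star (b r) ⬝ᵥ H *ᵥ b r =
        ∑ c, star (fun i => w (c, i)) ⬝ᵥ h *ᵥ (fun i => w (c, i)) := by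
      intro r
      have : ∀ p : A × β, (fun i => b r (p, i)) = x r p.1 • fun i => w (p.2, i) := by
        intro p; ext i; simp [hb]
      rw [hHdef, dotProduct_one_kronecker_mulVec, Fintype.sum_prod_type_right]
      refine Finset.sum_congr rfl fun c _ => ?_
      simp only [this, star_smul, smul_dotProduct, mulVec_smul, dotProduct_smul, smul_smul]
      rw [← Finset.sum_smul]
      have h1 := hx r
      rw [dotProduct_comm, dotProduct] at h1
      simp only [Pi.star_apply] at h1
      rw [h1, one_smul]
    have hba : ∀ r, star (b r) ⬝ᵥ a r = ∑ k, star (w k) * (star (x r) ⬝ᵥ T k *ᵥ x r) := by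
      intro r
      have : star (b r) ⬝ᵥ a r = ∑ c : A, ∑ k : β × κ,
          star (b r ((c, k.1), k.2)) * a r ((c, k.1), k.2) := by
        simp only [dotProduct, Fintype.sum_prod_type, Pi.star_apply]
      rw [this, Finset.sum_comm]
      refine Finset.sum_congr rfl fun k _ => ?_
      rw [dotProduct, Finset.mul_sum]
      refine Finset.sum_congr rfl fun c _ => ?_
      have : a r ((c, k.1), k.2) = (T k *ᵥ x r) c := by rw [ha]; rfl
      rw [this, hb, star_mul, mul_assoc, Pi.star_apply]
    have hsum : ∑ r, star (b r) ⬝ᵥ a r = 2 * (√N : ℝ) := by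
      rw [← hwv, Finset.sum_congr rfl fun r _ => hba r, Finset.sum_comm, dotProduct,
        Finset.mul_sum]
      refine Finset.sum_congr rfl fun k _ => ?_
      rw [← Finset.mul_sum, hv, Pi.star_apply]; ring
    have hN : N ≤ ((Complex.normSq (star (b 0) ⬝ᵥ a 0)) +
        (Complex.normSq (star (b 1) ⬝ᵥ a 1))) / 2 := by
      have h1 := congrArg Complex.re hsum
      simp only [Fin.sum_univ_two, Complex.add_re, Complex.re_mul_ofReal] at h1
      have h2 : N = √N * √N := (Real.mul_self_sqrt
        (Finset.sum_nonneg fun _ _ => Complex.normSq_nonneg _)).symm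
      rw [Complex.normSq_apply, Complex.normSq_apply]
      norm_num at h1
      have h3 : √N = ((star (b 0) ⬝ᵥ a 0).re + (star (b 1) ⬝ᵥ a 1).re) / 2 := by linarith
      rw [h2, h3]
      nlinarith [sq_nonneg ((star (b 0) ⬝ᵥ a 0).re - (star (b 1) ⬝ᵥ a 1).re),
        sq_nonneg (star (b 0) ⬝ᵥ a 0).im, sq_nonneg (star (b 1) ⬝ᵥ a 1).im]
    have hswap : ∀ r, Complex.normSq (star (a r) ⬝ᵥ b r) = Complex.normSq (star (b r) ⬝ᵥ a r) := by
      intro r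
      rw [star_dotProduct (a r) (b r)]; exact Complex.normSq_conj _
    have e0 := expectation_sub_le hH hlo hhi (haa 0) (hbb 0)
    have e1 := expectation_sub_le hH hlo hhi (hbb 1) (haa 1)
    rw [hbH] at e0 e1
    rw [hsp] at e0 e1
    rw [hswap] at e0
    have c0 := normSq_dotProduct_le (b 0) (a 0)
    have c1 := normSq_dotProduct_le (b 1) (a 1)
    rw [haa, hbb] at c0 c1
    simp only [Complex.one_re, mul_one] at c0 c1
    have s0 := Real.sq_sqrt (sub_nonneg.2 c0)
    have s1 := Real.sq_sqrt (sub_nonneg.2 c1)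
    set u0 := √(1 - Complex.normSq (star (b 0) ⬝ᵥ a 0))
    set u1 := √(1 - Complex.normSq (star (b 1) ⬝ᵥ a 1))
    have hu : u0 + u1 ≤ 2 * ε := by
      refine abs_le_of_sq_le_sq' ?_ (by positivity) |>.2
      nlinarith [sq_nonneg (u0 - u1)]
    nlinarith

end Decoupling

/-! ### Charge conservation -/

section ChargeConservation

variable {A B C κ ι : Type*} [Fintype A] [DecidableEq A] [Fintype B] [DecidableEq B]
  [Fintype C] [DecidableEq C] [Fintype κ] [DecidableEq κ] [Fintype ι] [DecidableEq ι]

theorem krausMap_comp_equiv (K : κ → Matrix B A ℂ) (e : ι ≃ κ) :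
    krausMap (K ∘ e) = krausMap K :=
  Equiv.sum_comp e fun i => conjMap (K i)

theorem isHermitian_dualMap_krausMap (M : ι → Matrix B A ℂ) {H : Matrix B B ℂ}
    (hH : H.IsHermitian) : (dualMap (krausMap M) H).IsHermitian := by
  rw [dualMap_krausMap, IsHermitian, conjTranspose_sum]
  refine Finset.sum_congr rfl fun i _ => ?_
  simp [hH.eq, Matrix.mul_assoc]

/-- Averaged over the Kraus operators of recovery and encoding, the environment observable `h` has
the encoded charge as its pullback; the recovery drops out because it preserves the trace. -/
theorem sum_recovered_eq_dualMap {γ : Type*} [Fintype γ] {R : γ → Matrix A C ℂ}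
    (hR : IsKrausFamily R) (K : κ → Matrix C B ℂ) (M : ι → Matrix B A ℂ) {h : Matrix κ κ ℂ}
    {H : Matrix B B ℂ} (hH : H = ∑ i, ∑ j, h i j • ((K i)ᴴ * K j)) :
    ∑ b : γ × ι, ∑ i, ∑ j, h i j • ((R b.1 * (K i * M b.2))ᴴ * (R b.1 * (K j * M b.2))) =
      dualMap (krausMap M) H := by
  rw [dualMap_krausMap, Fintype.sum_prod_type_right]
  refine Finset.sum_congr rfl fun m _ => ?_
  have e : ∀ c i j, (R c * (K i * M m))ᴴ * (R c * (K j * M m)) =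
      (M m)ᴴ * ((K i)ᴴ * ((R c)ᴴ * R c) * K j) * M m := by
    intro c i j; simp [Matrix.mul_assoc]
  simp only [e]
  rw [Finset.sum_comm, hH, Matrix.mul_sum, Matrix.sum_mul]
  refine Finset.sum_congr rfl fun i _ => ?_
  rw [Finset.sum_comm, Matrix.mul_sum, Matrix.sum_mul]
  refine Finset.sum_congr rfl fun j _ => ?_
  rw [← Finset.smul_sum, ← Matrix.sum_mul, ← Matrix.mul_sum, ← Matrix.sum_mul, ← Matrix.mul_sum,
    hR, Matrix.mul_one, Matrix.mul_smul, Matrix.smul_mul]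

theorem isKrausFamily_comp_equiv {K : κ → Matrix B A ℂ} (hK : IsKrausFamily K) (e : ι ≃ κ) :
    IsKrausFamily (K ∘ e) :=
  (Equiv.sum_comp e fun i => (K i)ᴴ * K i).trans hK

theorem charge_sub_le_of_kraus {γ : Type*} [Fintype γ] [DecidableEq γ] {R : γ → Matrix A C ℂ}
    (hR : IsKrausFamily R) {K : κ → Matrix C B ℂ} (hK : IsKrausFamily K) {M : ι → Matrix B A ℂ}
    (hM : IsKrausFamily M) {h : Matrix κ κ ℂ} (hh : h.IsHermitian) {H : Matrix B B ℂ}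
    (hH : H = ∑ i, ∑ j, h i j • ((K i)ᴴ * K j)) {x : Fin 2 → A → ℂ}
    (hx : ∀ r, star (x r) ⬝ᵥ x r = 1) :
    (star (x 0) ⬝ᵥ dualMap (krausMap M) H *ᵥ x 0).re -
        (star (x 1) ⬝ᵥ dualMap (krausMap M) H *ᵥ x 1).re ≤
      2 * channelPurifiedDist (krausMap R ∘ₗ (krausMap K ∘ₗ krausMap M)) LinearMap.id *
        spread h := by
  -- Regroup the Kraus indices so that the environment of the noise comes last.
  let e : (γ × ι) × κ ≃ γ × (κ × ι) :=
    ⟨fun p => (p.1.1, (p.2, p.1.2)), fun q => ((q.1, q.2.2), q.2.1), fun _ => rfl, fun _ => rfl⟩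
  have hfam := isKrausFamily_comp_equiv (isKrausFamily_comp hR (isKrausFamily_comp hK hM)) e
  have key := environment_expectation_sub_le hfam hh hx
  rw [krausMap_comp_equiv] at key
  rw [krausMap_comp, krausMap_comp, ← sum_recovered_eq_dualMap hR K M hH]
  exact key

/-- A recovery channel of inaccuracy `ε` keeps the encoded charges of two logical states within
`2 ε Δh` of each other, since `h` represents the physical charge on the environment of the
noise. -/
theorem logical_charge_sub_le {K : κ → Matrix C B ℂ} (hK : IsKrausFamily K)
    {E : SuperOp A B} (hE : IsChannel E) {Rec : SuperOp C A} (hRec : IsChannel Rec)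
    {h : Matrix κ κ ℂ} (hh : h.IsHermitian) {H : Matrix B B ℂ}
    (hH : H = ∑ i, ∑ j, h i j • ((K i)ᴴ * K j)) {x : Fin 2 → A → ℂ}
    (hx : ∀ r, star (x r) ⬝ᵥ x r = 1) :
    (star (x 0) ⬝ᵥ dualMap E H *ᵥ x 0).re - (star (x 1) ⬝ᵥ dualMap E H *ᵥ x 1).re ≤
      2 * channelPurifiedDist (Rec ∘ₗ (krausMap K ∘ₗ E)) LinearMap.id * spread h := by
  obtain ⟨r, R, hR, rfl⟩ := hRec
  obtain ⟨s, M, hM, rfl⟩ := hE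
  exact charge_sub_le_of_kraus hR hK hM hh hH hx

theorem le_mul_sInf {s : Set ℝ} (hs : s.Nonempty) {c g : ℝ} (hc : 0 ≤ c)
    (h : ∀ e ∈ s, g ≤ c * e) : g ≤ c * sInf s := by
  rcases hc.eq_or_lt with rfl | hc'
  · obtain ⟨e, he⟩ := hs
    simpa using h e he
  · rw [← div_le_iff₀' hc']
    exact le_csInf hs fun e he => (div_le_iff₀' hc').2 (h e he)

/-- There is a recovery channel, so `qecInaccuracy` is an infimum over a nonempty set. -/
theorem exists_isChannel [Nonempty A] [Nonempty B] : ∃ Φ : SuperOp A B, IsChannel Φ := by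
  obtain ⟨b⟩ := ‹Nonempty B›
  let e := Fintype.equivFin A
  refine ⟨_, Fintype.card A, fun i => single b (e.symm i) 1, ?_, rfl⟩
  rw [IsKrausFamily, Equiv.sum_comp e.symm fun a => (single b a (1 : ℂ))ᴴ * single b a 1]
  simp [conjTranspose_single, Matrix.sum_single_one]

theorem nonempty_of_isKrausFamily [Nonempty A] {K : κ → Matrix B A ℂ} (hK : IsKrausFamily K) :
    Nonempty B := by
  by_contra hB
  rw [not_nonempty_iff] at hB
  obtain ⟨a⟩ := ‹Nonempty A›
  have := congrFun (congrFun hK a) a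
  simp [Matrix.sum_apply, Matrix.mul_apply] at this

/-- A Hermitian `H` in the Kraus span has a Hermitian coefficient matrix, so `frakJ` is an infimum
over a nonempty set. -/
theorem exists_isHermitian_of_HKS {H : Matrix A A ℂ} (hH : H.IsHermitian) {K : κ → Matrix B A ℂ}
    (h : HKS H K) :
    ∃ h : Matrix κ κ ℂ, h.IsHermitian ∧ H = ∑ i, ∑ j, h i j • ((K i)ᴴ * K j) := by
  have hset : {M | ∃ i j, M = (K i)ᴴ * K j} = Set.range fun p : κ × κ => (K p.1)ᴴ * K p.2 := by
    ext M; simp [eq_comm]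
  rw [HKS, hset, Submodule.mem_span_range_iff_exists_fun] at h
  obtain ⟨c, hc⟩ := h
  rw [Fintype.sum_prod_type] at hc
  -- Taking adjoints, `star (c (j, i))` represents `H` as well; average it with `c`.
  have hc' : ∑ i, ∑ j, star (c (j, i)) • ((K i)ᴴ * K j) = H := by
    rw [← hH.eq, ← hc, conjTranspose_sum, Finset.sum_comm]
    refine Finset.sum_congr rfl fun i _ => ?_
    rw [conjTranspose_sum]
    refine Finset.sum_congr rfl fun j _ => ?_
    simp
  refine ⟨Matrix.of fun i j => (1 / 2 : ℂ) * (c (i, j) + star (c (j, i))), ?_, ?_⟩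
  · ext i j
    simp [add_comm]
  · have : ∑ i, ∑ j, ((1 / 2 : ℂ) * (c (i, j) + star (c (j, i)))) • ((K i)ᴴ * K j) =
        (1 / 2 : ℂ) • (H + H) := by
      nth_rewrite 1 [← hc, ← hc']
      simp only [← Finset.sum_add_distrib, Finset.smul_sum, mul_smul, add_smul]
    simp only [of_apply]
    rw [this, ← two_smul ℂ H, smul_smul]
    simp

/-- The tradeoff between charge conservation and error correction, for arbitrary encodings. -/
theorem spread_le_chargeViolation_add [Nonempty A] {HA : Matrix A A ℂ} (hHA : HA.IsHermitian)
    {HB : Matrix B B ℂ} (hHB : HB.IsHermitian) {K : κ → Matrix C B ℂ} (hK : IsKrausFamily K)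
    (hHKS : HKS HB K) {E : SuperOp A B} (hE : IsChannel E) :
    spread HA ≤ chargeViolation HA HB E + 2 * qecInaccuracy (krausMap K ∘ₗ E) * frakJ HB K := by
  obtain ⟨x, y, μ, ν, hx, hy, hHx, hHy, hsp, -⟩ := exists_extremal_eigenvectors hHA
  have hherm : (HA - dualMap E HB).IsHermitian := by
    obtain ⟨s, M, -, rfl⟩ := hE
    exact hHA.sub (isHermitian_dualMap_krausMap M hHB)
  have h1 := (isHermitian_form_bounds hherm x).2
  have h2 := (isHermitian_form_bounds hherm y).1
  rw [sub_mulVec, dotProduct_sub, hHx, dotProduct_smul, hx] at h1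
  rw [sub_mulVec, dotProduct_sub, hHy, dotProduct_smul, hy] at h2
  simp at h1 h2
  have hgap : (star x ⬝ᵥ dualMap E HB *ᵥ x).re - (star y ⬝ᵥ dualMap E HB *ᵥ y).re ≤
      2 * qecInaccuracy (krausMap K ∘ₗ E) * frakJ HB K := by
    have hB : Nonempty B := by
      obtain ⟨s, M, hM, -⟩ := hE
      exact nonempty_of_isKrausFamily hM
    have hC : Nonempty C := nonempty_of_isKrausFamily hK
    obtain ⟨Φ, hΦ⟩ := exists_isChannel (A := C) (B := A)
    obtain ⟨h₀, hh₀, hHB₀⟩ := exists_isHermitian_of_HKS hHB hHKS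
    have hq : 0 ≤ qecInaccuracy (krausMap K ∘ₗ E) := by
      refine Real.sInf_nonneg ?_
      rintro _ ⟨Rec, -, rfl⟩
      exact channelPurifiedDist_nonneg _ _
    rw [frakJ]
    refine le_mul_sInf ?_ (mul_nonneg zero_le_two hq) ?_
    · exact ⟨spread h₀, h₀, hh₀, hHB₀, rfl⟩
    rintro _ ⟨h, hh, hHBh, rfl⟩
    rw [mul_right_comm, qecInaccuracy]
    refine le_mul_sInf ?_ (mul_nonneg zero_le_two (spread_nonneg h)) ?_
    · exact ⟨_, Φ, hΦ, rfl⟩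
    rintro _ ⟨Rec, hRec, rfl⟩
    rw [mul_right_comm]
    exact logical_charge_sub_le hK hE hRec hh hHBh (x := ![x, y])
      (by simp [Fin.forall_fin_two, hx, hy])
  rw [hsp, chargeViolation, spread]
  linarith

end ChargeConservation

/-! ### Derivatives along the unitary flow -/

section Evolution

variable {A B C : Type*} [Fintype A] [DecidableEq A] [Fintype B] [DecidableEq B]
  [Fintype C] [DecidableEq C]

theorem evol_zero (H : Matrix A A ℂ) : evol H 0 = 1 := by
  simp [evol, NormedSpace.exp_zero]

theorem conjTranspose_evol_mul_self {H : Matrix A A ℂ} (hH : H.IsHermitian) (t : ℝ) :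
    (evol H t)ᴴ * evol H t = 1 := by
  have h : ((-Complex.I * (t : ℂ)) • H)ᴴ = -((-Complex.I * (t : ℂ)) • H) := by
    rw [conjTranspose_smul, hH.eq, ← neg_smul]; simp
  rw [evol, ← Matrix.exp_conjTranspose, h, ← Matrix.exp_add_of_commute]
  · simp [NormedSpace.exp_zero]
  · exact (Commute.refl _).neg_left

theorem evol_mul_conjTranspose_self {H : Matrix A A ℂ} (hH : H.IsHermitian) (t : ℝ) :
    evol H t * (evol H t)ᴴ = 1 :=
  mul_eq_one_comm.1 (conjTranspose_evol_mul_self hH t)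

theorem hasDerivAt_evol_apply (H : Matrix A A ℂ) (t : ℝ) (i j : A) :
    HasDerivAt (fun s => evol H s i j) (((-Complex.I) • (H * evol H t)) i j) t := by
  let _ : NormedRing (Matrix A A ℂ) := Matrix.linftyOpNormedRing
  let _ : NormedAlgebra ℂ (Matrix A A ℂ) := Matrix.linftyOpNormedAlgebra
  let _ : NormedAlgebra ℝ (Matrix A A ℂ) := NormedAlgebra.restrictScalars ℝ ℂ _
  have h := hasDerivAt_exp_smul_const' (𝕂 := ℝ) ((-Complex.I) • H) t
  have he : ∀ s : ℝ, evol H s = NormedSpace.exp (s • ((-Complex.I) • H)) := by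
    intro s
    rw [evol, mul_comm, mul_smul]; rfl
  have h' : HasDerivAt (fun s => evol H s) ((-Complex.I) • (H * evol H t)) t := by
    simp only [he]
    rw [← Matrix.smul_mul]
    exact h
  exact hasDerivAt_pi.1 (hasDerivAt_pi.1 h' i) j

theorem hasDerivAt_mul_apply {X X' : ℝ → Matrix A B ℂ} {Y Y' : ℝ → Matrix B C ℂ} {t : ℝ}
    (hX : ∀ i j, HasDerivAt (fun s => X s i j) (X' t i j) t)
    (hY : ∀ i j, HasDerivAt (fun s => Y s i j) (Y' t i j) t) (i : A) (j : C) :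
    HasDerivAt (fun s => (X s * Y s) i j) ((X' t * Y t + X t * Y' t) i j) t := by
  simp only [Matrix.add_apply, Matrix.mul_apply, ← Finset.sum_add_distrib]
  exact HasDerivAt.fun_sum fun k _ => (hX i k).mul (hY k j)

/-- The generator of the flow `X ↦ exp(-i t HB) X exp(i t HA)`. -/
def flowGenerator (HA : Matrix A A ℂ) (HB : Matrix B B ℂ) (X : Matrix B A ℂ) : Matrix B A ℂ :=
  (-Complex.I) • (HB * X - X * HA)

theorem hasDerivAt_flow_apply {HA : Matrix A A ℂ} (hHA : HA.IsHermitian) (HB : Matrix B B ℂ)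
    (V : Matrix B A ℂ) (t : ℝ) (i : B) (j : A) :
    HasDerivAt (fun s => (evol HB s * V * (evol HA s)ᴴ) i j)
      (flowGenerator HA HB (evol HB t * V * (evol HA t)ᴴ) i j) t := by
  have h1 : ∀ i j, HasDerivAt (fun s => (evol HB s * V) i j)
      ((fun t => (-Complex.I) • (HB * evol HB t * V)) t i j) t := by
    intro i j
    refine (hasDerivAt_mul_apply (X' := fun t => (-Complex.I) • (HB * evol HB t))
      (Y := fun _ => V) (Y' := fun _ => 0) (hasDerivAt_evol_apply HB t)
      (fun i j => hasDerivAt_const t (V i j)) i j).congr_deriv ?_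
    simp
  have h2 : ∀ i j, HasDerivAt (fun s => (evol HA s)ᴴ i j)
      ((fun t => Complex.I • ((evol HA t)ᴴ * HA)) t i j) t := by
    intro i j
    refine (hasDerivAt_evol_apply HA t j i).star.congr_deriv ?_
    rw [← conjTranspose_apply, conjTranspose_smul, conjTranspose_mul, hHA.eq]
    simp
  refine (hasDerivAt_mul_apply (Y := fun s => (evol HA s)ᴴ)
    (X' := fun t => (-Complex.I) • (HB * evol HB t * V))
    (Y' := fun t => Complex.I • ((evol HA t)ᴴ * HA)) h1 h2 i j).congr_deriv ?_
  rw [flowGenerator]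
  simp only [Matrix.smul_mul, Matrix.mul_smul, smul_sub, neg_smul, sub_neg_eq_add, Matrix.neg_mul,
    Matrix.mul_assoc]

theorem hasDerivAt_flowGenerator_apply {HA : Matrix A A ℂ} {HB : Matrix B B ℂ}
    {X X' : ℝ → Matrix B A ℂ} {t : ℝ} (hX : ∀ i j, HasDerivAt (fun s => X s i j) (X' t i j) t)
    (i : B) (j : A) :
    HasDerivAt (fun s => flowGenerator HA HB (X s) i j) (flowGenerator HA HB (X' t) i j) t := by
  have h1 := hasDerivAt_mul_apply (X := fun _ => HB) (X' := fun _ => 0) (t := t)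
    (fun i j => hasDerivAt_const t (HB i j)) hX i j
  have h2 := hasDerivAt_mul_apply (Y := fun _ => HA) (Y' := fun _ => 0) (t := t) hX
    (fun i j => hasDerivAt_const t (HA i j)) i j
  refine ((h1.fun_sub h2).const_mul (-Complex.I)).congr_deriv ?_
  simp [flowGenerator]

theorem hasDerivAt_dotProduct_mulVec {X X' : ℝ → Matrix B A ℂ} {t : ℝ}
    (hX : ∀ i j, HasDerivAt (fun s => X s i j) (X' t i j) t) (u : B → ℂ) (w : A → ℂ) :
    HasDerivAt (fun s => u ⬝ᵥ X s *ᵥ w) (u ⬝ᵥ X' t *ᵥ w) t := by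
  simp only [dotProduct, mulVec]
  exact HasDerivAt.fun_sum fun i _ =>
    (HasDerivAt.fun_sum fun j _ => (hX i j).mul_const (w j)).const_mul (u i)

theorem iteratedDeriv_two_one_sub_normSq {g g' : ℝ → ℂ} {g'' : ℂ} {t : ℝ}
    (hg : ∀ s, HasDerivAt g (g' s) s) (hg' : HasDerivAt g' g'' t) :
    iteratedDeriv 2 (fun s => 1 - Complex.normSq (g s)) t =
      -2 * (Complex.normSq (g' t) + (star (g t) * g'').re) := by
  have re : ∀ {f : ℝ → ℂ} {f' : ℂ} {s : ℝ}, HasDerivAt f f' s →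
      HasDerivAt (fun s => (f s).re) f'.re s := fun h =>
    (Complex.reCLM.hasFDerivAt.comp_hasDerivAt _ h)
  have im : ∀ {f : ℝ → ℂ} {f' : ℂ} {s : ℝ}, HasDerivAt f f' s →
      HasDerivAt (fun s => (f s).im) f'.im s := fun h =>
    (Complex.imCLM.hasFDerivAt.comp_hasDerivAt _ h)
  have h1 : deriv (fun s => 1 - Complex.normSq (g s)) =
      fun s => -(2 * ((g s).re * (g' s).re + (g s).im * (g' s).im)) := by
    funext s
    have := (((re (hg s)).fun_mul (re (hg s))).fun_add ((im (hg s)).fun_mul (im (hg s)))).const_sub 1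
    refine HasDerivAt.deriv ?_
    simp only [Complex.normSq_apply]
    exact this.congr_deriv (by ring)
  rw [iteratedDeriv_succ, iteratedDeriv_one, h1]
  have := ((((re (hg t)).fun_mul (re hg')).fun_add ((im (hg t)).fun_mul (im hg'))).const_mul 2).fun_neg
  rw [HasDerivAt.deriv this]
  simp [Complex.normSq_apply]
  ring

end Evolution

/-! ### Local covariance violation of isometric encodings -/

section LocalViolation

variable {A B : Type*} [Fintype A] [DecidableEq A] [Fintype B] [DecidableEq B]

theorem extend_conjMap_vecMulVec {R : Type*} (K : Matrix B A ℂ) (ψ : A × R → ℂ) :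
    extend R (conjMap K) (vecMulVec ψ (star ψ)) =
      vecMulVec (fun x : B × R => (K *ᵥ fun a => ψ (a, x.2)) x.1)
        (star fun x : B × R => (K *ᵥ fun a => ψ (a, x.2)) x.1) := by
  simpa [krausMap] using extend_krausMap_vecMulVec (fun _ : Unit => K) ψ

theorem conjMap_comp {C : Type*} [Fintype C] [DecidableEq C] (K : Matrix C B ℂ)
    (M : Matrix B A ℂ) : conjMap K ∘ₗ conjMap M = conjMap (K * M) := by
  ext1 X
  simp [conjMap, Matrix.mul_assoc]

theorem conjTranspose_mulVec_norm_sq_le {V : Matrix B A ℂ} (hV : Vᴴ * V = 1) (w : B → ℂ) :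
    (star (Vᴴ *ᵥ w) ⬝ᵥ (Vᴴ *ᵥ w)).re ≤ (star w ⬝ᵥ w).re := by
  have h1 : star w ⬝ᵥ V *ᵥ (Vᴴ *ᵥ w) = star (Vᴴ *ᵥ w) ⬝ᵥ (Vᴴ *ᵥ w) := by
    rw [dotProduct_mulVec, ← conjTranspose_conjTranspose V, ← star_mulVec,
      conjTranspose_conjTranspose]
  have h2 : star (V *ᵥ (Vᴴ *ᵥ w)) ⬝ᵥ w = star (Vᴴ *ᵥ w) ⬝ᵥ (Vᴴ *ᵥ w) := by
    rw [star_mulVec, ← dotProduct_mulVec]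
  have h3 : star (V *ᵥ (Vᴴ *ᵥ w)) ⬝ᵥ V *ᵥ (Vᴴ *ᵥ w) = star (Vᴴ *ᵥ w) ⬝ᵥ (Vᴴ *ᵥ w) := by
    rw [star_mulVec, ← dotProduct_mulVec, mulVec_mulVec, hV, one_mulVec]
  have h4 : 0 ≤ (star (w - V *ᵥ (Vᴴ *ᵥ w)) ⬝ᵥ (w - V *ᵥ (Vᴴ *ᵥ w))).re := by
    rw [star_dotProduct_self_re_eq]
    exact Finset.sum_nonneg fun _ _ => Complex.normSq_nonneg _
  rw [star_sub, sub_dotProduct, dotProduct_sub, dotProduct_sub, h1, h2, h3] at h4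
  simp at h4
  linarith

/-- The state QFI of an isometric encoding in a pure input state `ψ` is at least four times the
variance of the charge mismatch `HA - Vᴴ HB V`. -/
theorem four_mul_variance_le_stateQFI {HA : Matrix A A ℂ} (hHA : HA.IsHermitian)
    {HB : Matrix B B ℂ} (hHB : HB.IsHermitian) {V : Matrix B A ℂ} (hV : Vᴴ * V = 1) {ψ : A → ℂ}
    (hψ : star ψ ⬝ᵥ ψ = 1) {D : Matrix A A ℂ} (hD : D = HA - Vᴴ * HB * V) {R : Type*} [Unique R]
    [Fintype R] [DecidableEq R] :
    4 * ((star (D *ᵥ ψ) ⬝ᵥ (D *ᵥ ψ)).re - (star ψ ⬝ᵥ D *ᵥ ψ).re ^ 2) ≤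
      stateQFI (fun t => extend R (conjMap (evol HB t) ∘ₗ conjMap V ∘ₗ conjMap (evol HA t)ᴴ)
        (vecMulVec (fun p : A × R => ψ p.1) (star fun p : A × R => ψ p.1))) 0 := by
  set F : ℝ → Matrix B A ℂ := fun t => evol HB t * V * (evol HA t)ᴴ with hF
  have hFF : ∀ t, (F t)ᴴ * F t = 1 := by
    intro t
    have : (F t)ᴴ * F t = evol HA t * (Vᴴ * ((evol HB t)ᴴ * evol HB t) * V) * (evol HA t)ᴴ := by
      simp [hF, Matrix.mul_assoc]
    rw [this, conjTranspose_evol_mul_self hHB, Matrix.mul_one, hV, Matrix.mul_one,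
      evol_mul_conjTranspose_self hHA]
  have hF0 : F 0 = V := by simp [hF, evol_zero]
  have hunit : ∀ t, star (F t *ᵥ ψ) ⬝ᵥ (F t *ᵥ ψ) = 1 := by
    intro t
    rw [star_mulVec, ← dotProduct_mulVec, mulVec_mulVec, hFF, one_mulVec, hψ]
  have hR : ∀ u w : B → ℂ,
      star (fun p : B × R => u p.1) ⬝ᵥ (fun p : B × R => w p.1) = star u ⬝ᵥ w := by
    intro u w
    simp [dotProduct, Fintype.sum_prod_type]
  have hstate : (fun t => purifiedDist
      (extend R (conjMap (evol HB 0) ∘ₗ conjMap V ∘ₗ conjMap (evol HA 0)ᴴ)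
        (vecMulVec (fun p : A × R => ψ p.1) (star fun p : A × R => ψ p.1)))
      (extend R (conjMap (evol HB t) ∘ₗ conjMap V ∘ₗ conjMap (evol HA t)ᴴ)
        (vecMulVec (fun p : A × R => ψ p.1) (star fun p : A × R => ψ p.1))) ^ 2) =
      fun t => 1 - Complex.normSq (star (V *ᵥ ψ) ⬝ᵥ F t *ᵥ ψ) := by
    funext t
    have e : ∀ t, conjMap (evol HB t) ∘ₗ conjMap V ∘ₗ conjMap (evol HA t)ᴴ = conjMap (F t) := by
      intro t; rw [conjMap_comp, conjMap_comp, ← Matrix.mul_assoc]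
    rw [e, e, extend_conjMap_vecMulVec, extend_conjMap_vecMulVec,
      purifiedDist_sq_vecMulVec_vecMulVec ((hR _ _).trans (hunit 0)) ((hR _ _).trans (hunit t)),
      hR, hF0]
  have hG1 : ∀ s, HasDerivAt (fun t => star (V *ᵥ ψ) ⬝ᵥ F t *ᵥ ψ)
      (star (V *ᵥ ψ) ⬝ᵥ flowGenerator HA HB (F s) *ᵥ ψ) s := fun s =>
    hasDerivAt_dotProduct_mulVec (X' := fun s => flowGenerator HA HB (F s))
      (hasDerivAt_flow_apply hHA HB V s) _ _
  have hG2 : HasDerivAt (fun s => star (V *ᵥ ψ) ⬝ᵥ flowGenerator HA HB (F s) *ᵥ ψ)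
      (star (V *ᵥ ψ) ⬝ᵥ flowGenerator HA HB (flowGenerator HA HB (F 0)) *ᵥ ψ) 0 :=
    hasDerivAt_dotProduct_mulVec
      (X' := fun s => flowGenerator HA HB (flowGenerator HA HB (F s)))
      (hasDerivAt_flowGenerator_apply (X' := fun s => flowGenerator HA HB (F s))
        (hasDerivAt_flow_apply hHA HB V 0)) _ _
  rw [stateQFI, hstate, iteratedDeriv_two_one_sub_normSq hG1 hG2, hF0]
  obtain ⟨G, hG⟩ : ∃ G, G = HB * V - V * HA := ⟨_, rfl⟩
  have hVG : Vᴴ * G = -D := by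
    rw [hG, hD, Matrix.mul_sub, ← Matrix.mul_assoc, ← Matrix.mul_assoc, hV, Matrix.one_mul, neg_sub]
  have hDh : D.IsHermitian := by
    rw [hD]
    exact hHA.sub (by simp [IsHermitian, hHB.eq, Matrix.mul_assoc])
  have hV1 : star (V *ᵥ ψ) ⬝ᵥ V *ᵥ ψ = 1 := by simpa [hF0] using hunit 0
  have hfg : flowGenerator HA HB V = (-Complex.I) • G := by rw [flowGenerator, hG]
  have hfg2 : flowGenerator HA HB ((-Complex.I) • G) = -(HB * G - G * HA) := by
    rw [flowGenerator, Matrix.mul_smul, Matrix.smul_mul, ← smul_sub, smul_smul]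
    simp
  -- The first derivative of the overlap is `i⟨D⟩`.
  have hfirst : star (V *ᵥ ψ) ⬝ᵥ flowGenerator HA HB V *ᵥ ψ =
      Complex.I * (star ψ ⬝ᵥ D *ᵥ ψ) := by
    rw [hfg, smul_mulVec, dotProduct_smul, star_mulVec, ← dotProduct_mulVec, mulVec_mulVec, hVG,
      neg_mulVec, dotProduct_neg, smul_eq_mul]
    ring
  have hreal : (star ψ ⬝ᵥ D *ᵥ ψ).im = 0 := by
    have := congrArg Complex.im (star_dotProduct_comm_of_isHermitian hDh ψ ψ)
    simp at this
    linarith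
  -- The second derivative of the overlap is `-‖G ψ‖²`, up to an imaginary part.
  have hsecond : (star (V *ᵥ ψ) ⬝ᵥ (HB * G - G * HA) *ᵥ ψ).re = (star (G *ᵥ ψ) ⬝ᵥ G *ᵥ ψ).re := by
    have e1 : star (G *ᵥ ψ) ⬝ᵥ G *ᵥ ψ = star (V *ᵥ ψ) ⬝ᵥ (HB * G) *ᵥ ψ +
        star ψ ⬝ᵥ (HA * D) *ᵥ ψ := by
      nth_rewrite 1 [hG]
      rw [sub_mulVec, star_sub, sub_dotProduct, ← mulVec_mulVec, star_mulVec, hHB.eq,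
        ← dotProduct_mulVec, mulVec_mulVec, star_mulVec (V * HA), ← dotProduct_mulVec,
        mulVec_mulVec, conjTranspose_mul, Matrix.mul_assoc HAᴴ, hVG, hHA.eq, Matrix.mul_neg,
        neg_mulVec, dotProduct_neg, sub_neg_eq_add]
    have e2 : star (V *ᵥ ψ) ⬝ᵥ (G * HA) *ᵥ ψ = -(star ψ ⬝ᵥ (D * HA) *ᵥ ψ) := by
      rw [star_mulVec, ← dotProduct_mulVec, mulVec_mulVec, ← Matrix.mul_assoc, hVG, Matrix.neg_mul,
        neg_mulVec, dotProduct_neg]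
    have e3 : star ψ ⬝ᵥ (D * HA) *ᵥ ψ = star (star ψ ⬝ᵥ (HA * D) *ᵥ ψ) := by
      rw [← star_dotProduct_star, star_mulVec, star_star, conjTranspose_mul, hHA.eq, hDh.eq,
        ← dotProduct_mulVec, dotProduct_comm]
    rw [sub_mulVec, dotProduct_sub, e2, e3, e1]
    simp
  have hcontr := conjTranspose_mulVec_norm_sq_le hV (G *ᵥ ψ)
  rw [mulVec_mulVec, hVG, neg_mulVec, star_neg, neg_dotProduct_neg] at hcontr
  rw [hfirst, hV1, hfg, hfg2, neg_mulVec, dotProduct_neg]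
  simp only [star_one, one_mul, Complex.neg_re, hsecond, Complex.normSq_mul, Complex.normSq_I]
  rw [Complex.normSq_apply, hreal]
  nlinarith

theorem chargeViolation_le_localViolation [Nonempty A] {HA : Matrix A A ℂ}
    (hHA : HA.IsHermitian) {HB : Matrix B B ℂ} (hHB : HB.IsHermitian) {E : SuperOp A B}
    (hE : IsIsometric E) :
    ENNReal.ofReal (chargeViolation HA HB E) ≤ localViolation HA HB E := by
  obtain ⟨V, hV, rfl⟩ := hE
  have hdual : dualMap (conjMap V) HB = Vᴴ * HB * V := by
    simpa [krausMap] using dualMap_krausMap (fun _ : Unit => V) HB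
  obtain ⟨D, hD⟩ : ∃ D, D = HA - Vᴴ * HB * V := ⟨_, rfl⟩
  have hDh : D.IsHermitian := by
    rw [hD]
    exact hHA.sub (by simp [IsHermitian, hHB.eq, Matrix.mul_assoc])
  rw [chargeViolation, hdual, ← hD]
  obtain ⟨x, y, μ, ν, hx, hy, hDx, hDy, hsp, hxy⟩ := exists_extremal_eigenvectors hDh
  rw [hsp]
  by_cases hμν : μ = ν
  · simp [hμν]
  have hxy := hxy hμν
  have hyx : star y ⬝ᵥ x = 0 := by rw [star_dotProduct, hxy, star_zero]
  have hs : ((√2 : ℝ) : ℂ)⁻¹ * ((√2 : ℝ) : ℂ)⁻¹ = 1 / 2 := by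
    rw [← mul_inv, ← Complex.ofReal_mul, Real.mul_self_sqrt (by norm_num)]; simp
  have key : ∀ a b c d : ℂ, star (((√2 : ℝ) : ℂ)⁻¹ • (a • x + b • y)) ⬝ᵥ
      (((√2 : ℝ) : ℂ)⁻¹ • (c • x + d • y)) = (star a * c + star b * d) / 2 := by
    intro a b c d
    have hst : star (((√2 : ℝ) : ℂ)⁻¹) = ((√2 : ℝ) : ℂ)⁻¹ := by simp
    rw [star_smul, smul_dotProduct, dotProduct_smul, smul_smul, hst, hs]
    simp [star_add, star_smul, add_dotProduct, dotProduct_add, smul_dotProduct, dotProduct_smul,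
      hx, hy, hxy, hyx]
    ring
  obtain ⟨ψ, hψ⟩ : ∃ ψ, ψ = ((√2 : ℝ) : ℂ)⁻¹ • ((1 : ℂ) • x + (1 : ℂ) • y) := ⟨_, rfl⟩
  have hDψ : D *ᵥ ψ = ((√2 : ℝ) : ℂ)⁻¹ • ((μ : ℂ) • x + (ν : ℂ) • y) := by
    rw [hψ, mulVec_smul, mulVec_add, mulVec_smul, mulVec_smul, hDx, hDy, one_smul, one_smul]
  have hψ1 : star ψ ⬝ᵥ ψ = 1 := by rw [hψ, key]; norm_num
  have hQ := four_mul_variance_le_stateQFI hHA hHB hV hψ1 hD (R := Fin 1)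
  rw [hDψ, key, hψ, key] at hQ
  have hvar : 4 * (((star (μ : ℂ) * μ + star (ν : ℂ) * ν) / 2).re -
      (((star (1 : ℂ) * μ + star (1 : ℂ) * ν) / 2).re) ^ 2) = (μ - ν) ^ 2 := by
    have e1 : (star (μ : ℂ) * μ + star (ν : ℂ) * ν) / 2 = (((μ * μ + ν * ν) / 2 : ℝ) : ℂ) := by
      simp
    have e2 : (star (1 : ℂ) * μ + star (1 : ℂ) * ν) / 2 = (((μ + ν) / 2 : ℝ) : ℂ) := by simp
    rw [e1, e2, Complex.ofReal_re, Complex.ofReal_re]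
    ring
  rw [hvar, ← hψ] at hQ
  have hstate : IsState (vecMulVec (fun p : A × Fin 1 => ψ p.1) (star fun p : A × Fin 1 => ψ p.1)) :=
    isState_vecMulVec (by rw [← hψ1]; simp [dotProduct, Fintype.sum_prod_type])
  have hle : ENNReal.ofReal ((μ - ν) ^ 2) ≤ channelQFI
      (fun θ => conjMap (evol HB θ) ∘ₗ conjMap V ∘ₗ conjMap (evol HA θ)ᴴ) 0 :=
    le_iSup_of_le 1 (le_iSup_of_le _ (le_iSup_of_le hstate (ENNReal.ofReal_le_ofReal hQ)))
  have h0 : 0 ≤ μ - ν := hsp ▸ spread_nonneg D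
  rw [localViolation]
  refine le_trans (le_of_eq ?_) (ENNReal.rpow_le_rpow hle (by norm_num))
  rw [ENNReal.ofReal_rpow_of_nonneg (sq_nonneg _) (by norm_num), ← Real.sqrt_eq_rpow,
    Real.sqrt_sq h0]

end LocalViolation

end CovariantCodes

end

theorem theorem3 {L S S' κ : Type*}
    [Fintype L] [DecidableEq L] [Nonempty L] [Fintype S] [DecidableEq S]
    [Fintype S'] [DecidableEq S'] [Fintype κ] [DecidableEq κ]
    (HL : Matrix L L ℂ) (hHL : HL.IsHermitian)
    (HS : Matrix S S ℂ) (hHS : HS.IsHermitian)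
    (K : κ → Matrix S' S ℂ) (hK : CovariantCodes.IsKrausFamily K)
    (hHKS : CovariantCodes.HKS HS K)
    (E : CovariantCodes.SuperOp L S) (hE : CovariantCodes.IsChannel E) :
    (CovariantCodes.IsIsometric E →
      ENNReal.ofReal (CovariantCodes.spread HL) ≤
        CovariantCodes.localViolation HL HS E +
          ENNReal.ofReal (2 * CovariantCodes.qecInaccuracy (CovariantCodes.krausMap K ∘ₗ E) *
            CovariantCodes.frakJ HS K)) ∧
    CovariantCodes.spread HL ≤
      CovariantCodes.chargeViolation HL HS E +
        2 * CovariantCodes.qecInaccuracy (CovariantCodes.krausMap K ∘ₗ E) *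
          CovariantCodes.frakJ HS K := by
  have h := CovariantCodes.spread_le_chargeViolation_add hHL hHS hK hHKS hE
  refine ⟨fun hiso => ?_, h⟩
  exact (ENNReal.ofReal_le_ofReal h).trans (ENNReal.ofReal_add_le.trans
    (add_le_add_left (CovariantCodes.chargeViolation_le_localViolation hHL hHS hiso) _))
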